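/- Let $M:\mathbb{R}\to\mathbb{R}$ be twice continuously differentiable with $M(v)\to 0$ and $M'(v)\to 0$ as $v\to-\infty$, and let $a\in\mathbb{R}$. In coordinates $(v,r,\vartheta,\psi)\in\mathbb{R}\times(0,\infty)\times(0,\pi)\times(0,2\pi)$ consider the Kerr--Vaidya metric $$ds^2=-\Big(1-\tfrac{2M(v)r}{\rho^2}\Big)dv^2+2\,dv\,dr-\tfrac{4M(v)ar\sin^2\vartheta}{\rho^2}\,dv\,d\psi-2a\sin^2\vartheta\,dr\,d\psi+\rho^2d\vartheta^2+\tfrac{(r^2+a^2)^2-\Delta a^2\sin^2\vartheta}{\rho^2}\sin^2\vartheta\,d\psi^2,$$ where $\rho^2=r^2+a^2\cos^2\vartheta$ and $\Delta=r^2-2M(v)r+a^2$. Let $G^{ab}$ be its Einstein tensor and $\phi=\partial_\psi$. Then $\phi$ is a Killing vector field, and the current $I^a=G^{ab}\phi_b$ is covariantly conserved, $\nabla_aI^a=0$. For $r>0$ and $v\in\mathbb{R}$ let $\Sigma_r$ be the part, at advanced times less than $v$, of the hypersurface of constant $r$, with normal covector $n=dr$ and volume form $d\mathrm{vol}_{\Sigma_r}=\sqrt{-\det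 g}\,dv\,d\vartheta\,d\psi$. The charge $$Q_\phi=-\frac1{8\pi}\int_{\Sigma_r}I^an_a\,d\mathrm{vol}_{\Sigma_r}$$ exists, as the limit for $v_0\to-\infty$ of the integrals over the advanced times in $(v_0,v)$, and equals $$Q_\phi=M(v)\,a-M'(v)\left(\frac{(r^2+a^2)^2}{2a^2}\arctan\Big(\frac ar\Big)-\frac{r^3}{2a}-\frac{5ar}{6}\right),$$ where for $a=0$ the bracket is read as its limit $0$. For every $v$, it converges as $r\to\infty$ to the angular momentum $L_{\mathrm{Kerr}}=M(v)a$ of the stationary Kerr metric of mass $M(v)$ and rotation parameter $a$. -/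

import Mathlib

open Real Set Filter Topology MeasureTheory

noncomputable section

/-! ### Tensor calculus in a coordinate chart of a four-dimensional spacetime

A point is given by its four coordinates, a metric by the matrix of its components. -/

namespace Spacetime

/-- Coordinate points. -/
abbrev Pt := Fin 4 → ℝ

/-- The coordinate partial derivative `∂ᵢ f` at `x`. -/
def pd (i : Fin 4) (f : Pt → ℝ) (x : Pt) : ℝ :=
  deriv (fun t => f (Function.update x i t)) (x i)

/-- Christoffel symbols `Γᵏᵢⱼ = ½ gᵏˡ (∂ᵢ gⱼₗ + ∂ⱼ gᵢₗ - ∂ₗ gᵢⱼ)` of the Levi-Civita connection. -/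
def christoffel (g : Pt → Matrix (Fin 4) (Fin 4) ℝ) (k i j : Fin 4) (x : Pt) : ℝ :=
  (1 / 2) * ∑ l, (g x)⁻¹ k l *
    (pd i (fun y => g y j l) x + pd j (fun y => g y i l) x - pd l (fun y => g y i j) x)

/-- Riemann tensor
`Rᵏₗᵢⱼ = ∂ᵢ Γᵏⱼₗ - ∂ⱼ Γᵏᵢₗ + Γᵏᵢₚ Γᵖⱼₗ - Γᵏⱼₚ Γᵖᵢₗ`. -/
def riemann (g : Pt → Matrix (Fin 4) (Fin 4) ℝ) (k l i j : Fin 4) (x : Pt) : ℝ :=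
  pd i (christoffel g k j l) x - pd j (christoffel g k i l) x
    + ∑ p, (christoffel g k i p x * christoffel g p j l x
      - christoffel g k j p x * christoffel g p i l x)

/-- Ricci tensor `Rₗⱼ = Rᵏₗₖⱼ`. -/
def ricci (g : Pt → Matrix (Fin 4) (Fin 4) ℝ) (l j : Fin 4) (x : Pt) : ℝ :=
  ∑ k, riemann g k l k j x

/-- Ricci scalar `R = gⁱʲ Rᵢⱼ`. -/
def scalarCurvature (g : Pt → Matrix (Fin 4) (Fin 4) ℝ) (x : Pt) : ℝ :=
  ∑ i, ∑ j, (g x)⁻¹ i j * ricci g i j x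

/-- Einstein tensor `Gᵢⱼ = Rᵢⱼ - ½ R gᵢⱼ`. -/
def einstein (g : Pt → Matrix (Fin 4) (Fin 4) ℝ) (i j : Fin 4) (x : Pt) : ℝ :=
  ricci g i j x - (1 / 2) * scalarCurvature g x * g x i j

/-- Einstein tensor with both indices raised, `Gⁱʲ = gⁱᵏ gʲˡ Gₖₗ`. -/
def einsteinUp (g : Pt → Matrix (Fin 4) (Fin 4) ℝ) (i j : Fin 4) (x : Pt) : ℝ :=
  ∑ k, ∑ l, (g x)⁻¹ i k * (g x)⁻¹ j l * einstein g k l x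

/-- The covector field `Xⱼ = gⱼₖ Xᵏ`. -/
def lower (g : Pt → Matrix (Fin 4) (Fin 4) ℝ) (X : Pt → Fin 4 → ℝ) (j : Fin 4) (x : Pt) : ℝ :=
  ∑ k, g x j k * X x k

/-- The current `Iⁱ = Gⁱʲ Xⱼ` associated with a vector field `X`. -/
def current (g : Pt → Matrix (Fin 4) (Fin 4) ℝ) (X : Pt → Fin 4 → ℝ) (x : Pt) : Fin 4 → ℝ :=
  fun i => ∑ j, einsteinUp g i j x * lower g X j x

/-- Covariant derivative `∇ᵢ ωⱼ = ∂ᵢ ωⱼ - Γᵏᵢⱼ ωₖ` of a covector field. -/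
def covDerivCovector (g : Pt → Matrix (Fin 4) (Fin 4) ℝ) (ω : Fin 4 → Pt → ℝ)
    (i j : Fin 4) (x : Pt) : ℝ :=
  pd i (ω j) x - ∑ k, christoffel g k i j x * ω k x

/-- The Killing equation `∇ᵢ Xⱼ + ∇ⱼ Xᵢ = 0` at the point `x`. -/
def KillingAt (g : Pt → Matrix (Fin 4) (Fin 4) ℝ) (X : Pt → Fin 4 → ℝ) (x : Pt) : Prop :=
  ∀ i j, covDerivCovector g (lower g X) i j x + covDerivCovector g (lower g X) j i x = 0

/-- Covariant divergence `∇ᵢ Xⁱ = ∂ᵢ Xⁱ + Γⁱᵢₖ Xᵏ` of a vector field. -/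
def divergence (g : Pt → Matrix (Fin 4) (Fin 4) ℝ) (X : Pt → Fin 4 → ℝ) (x : Pt) : ℝ :=
  ∑ i, (pd i (fun y => X y i) x + ∑ k, christoffel g i i k x * X x k)

/-- `X` is covariantly conserved at `x`: the derivatives in the divergence exist, and
the divergence vanishes. -/
def ConservedAt (g : Pt → Matrix (Fin 4) (Fin 4) ℝ) (X : Pt → Fin 4 → ℝ) (x : Pt) : Prop :=
  (∀ i, DifferentiableAt ℝ (fun t => X (Function.update x i t) i) (x i)) ∧ divergence g X x = 0

end Spacetime

/-! ### The Kerr-Vaidya spacetime in ingoing coordinates `(v, r, ϑ, ψ)` -/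

namespace KerrVaidya

open Spacetime

/-- The coordinate domain `ℝ × ℝ₊ × (0, π) × (0, 2π)`. -/
def domain : Set Pt := {x | 0 < x 1 ∧ x 2 ∈ Ioo 0 π ∧ x 3 ∈ Ioo 0 (2 * π)}

/-- `ρ² = r² + a² cos² ϑ`. -/
def rhoSq (a : ℝ) (x : Pt) : ℝ := x 1 ^ 2 + a ^ 2 * cos (x 2) ^ 2

/-- `Δ = r² - 2 M(v) r + a²`. -/
def Del (M : ℝ → ℝ) (a : ℝ) (x : Pt) : ℝ := x 1 ^ 2 - 2 * M (x 0) * x 1 + a ^ 2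

/-- `Γ = r² + a²`. -/
def Gam (a : ℝ) (x : Pt) : ℝ := x 1 ^ 2 + a ^ 2

/-- The Kerr-Vaidya metric with mass function `M` and rotation parameter `a`,
`ds² = -(1 - 2 M r / ρ²) dv² + 2 dv dr - (4 M a r sin² ϑ / ρ²) dv dψ - 2 a sin² ϑ dr dψ
  + ρ² dϑ² + ((Γ² - Δ a² sin² ϑ) / ρ²) sin² ϑ dψ²`. -/
def metric (M : ℝ → ℝ) (a : ℝ) (x : Pt) : Matrix (Fin 4) (Fin 4) ℝ :=
  !![-(1 - 2 * M (x 0) * x 1 / rhoSq a x), 1, 0,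
        -(2 * M (x 0) * a * x 1 * sin (x 2) ^ 2 / rhoSq a x);
     1, 0, 0, -(a * sin (x 2) ^ 2);
     0, 0, rhoSq a x, 0;
     -(2 * M (x 0) * a * x 1 * sin (x 2) ^ 2 / rhoSq a x), -(a * sin (x 2) ^ 2), 0,
        (Gam a x ^ 2 - Del M a x * a ^ 2 * sin (x 2) ^ 2) / rhoSq a x * sin (x 2) ^ 2]

/-- The axial vector field `φ = ∂/∂ψ`. -/
def axial : Pt → Fin 4 → ℝ := fun _ => Pi.single 3 1

/-- The conserved current `Iᵃ = Gᵃᵇ φ_b`. -/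
def axialCurrent (M : ℝ → ℝ) (a : ℝ) : Pt → Fin 4 → ℝ := current (metric M a) axial

/-- The normal covector `n = dr` of the hypersurfaces of constant `r`. -/
def normal : Fin 4 → ℝ := Pi.single 1 1

/-- The density of `Iᵃ nₐ dvol` on the hypersurface `Σ_r` of constant `r`, as a function of
`p = (w, ϑ, ψ)`. The volume form of `Σ_r` belonging to `n = dr` is `√(-det g) dw dϑ dψ`. -/
def fluxDensity (M : ℝ → ℝ) (a r : ℝ) (p : ℝ × ℝ × ℝ) : ℝ :=
  (∑ i, axialCurrent M a ![p.1, r, p.2.1, p.2.2] i * normal i)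
    * √(-(metric M a ![p.1, r, p.2.1, p.2.2]).det)

/-- The part `v₀ < w < v` of the hypersurface `Σ_r`. -/
def slab (v₀ v : ℝ) : Set (ℝ × ℝ × ℝ) := Ioo v₀ v ×ˢ Ioo 0 π ×ˢ Ioo 0 (2 * π)

/-- The charge `-(8π)⁻¹ ∫ Iᵃ nₐ dvol` of the part `v₀ < w < v` of `Σ_r`. -/
def partialCharge (M : ℝ → ℝ) (a r v v₀ : ℝ) : ℝ :=
  -(1 / (8 * π)) * ∫ p in slab v₀ v, fluxDensity M a r p

/-- The charge `Q_φ = -(8π)⁻¹ ∫_{Σ_r} Iᵃ nₐ dvol` at advanced time `v`: the (improper) integral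
over the part `w < v` of `Σ_r`. -/
def charge (M : ℝ → ℝ) (a r v : ℝ) : ℝ := limUnder atBot (partialCharge M a r v)

/-- The function multiplying `-M'(v)` in the charge; at `a = 0`, where the expression is not
defined, it is given its limit as `a → 0`, which is `0`. -/
def ell (a r : ℝ) : ℝ :=
  if a = 0 then 0
  else (r ^ 2 + a ^ 2) ^ 2 / (2 * a ^ 2) * arctan (a / r) - r ^ 3 / (2 * a) - 5 * a * r / 6

end KerrVaidya

end

/-! In the variables `r`, `s = sin ϑ`, `c = cos ϑ`, `u = 1/ρ²` and `q = 1/sin ϑ`, all tensor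
components are polynomials, with `M` entering through `h = M r/ρ²` and its derivatives. Each tensor
identity then becomes a polynomial identity modulo `s² + c² = 1`, `u ρ² = 1`, `s q = 1`.

The metric does not depend on `ψ`, so `∂_ψ` is Killing. Since `Iⁱ = gⁱˡ Rₗ₃ - ½ R δⁱ₃`
(`current_single`), the scalar curvature enters `I³` only. That component is never computed: it is
independent of `ψ`, its coefficient `Γⁱᵢ₃` in the divergence is zero, and it does not contribute to
`Iᵃ nₐ`. Hence the components `Rₗ₃` (`ricci_eq`) suffice, and `∇ᵢIⁱ = 0` follows from the closed
forms of `I⁰, I¹, I²`.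

As `√(-det g) = ρ² sin ϑ`, the flux density is `M'(w) A(ϑ) + M''(w) B(ϑ)` (`fluxDensity_eq`).
Explicit antiderivatives give `∫A = -4a` and `∫B = 4 ell`; the `w`-integrals follow from the
fundamental theorem of calculus (`partialCharge_eq`), and the terms at `v₀` vanish as `v₀ → -∞`.
Finally `ell = O(1/r)`, because `|B| ≤ |a|³/r`. -/

noncomputable section

/-! ### Calculus in a chart -/

namespace Spacetime

/-- The partial derivative `∂ᵢ f` exists at `x` and equals `d`. -/
def HasPd (i : Fin 4) (f : Pt → ℝ) (d : ℝ) (x : Pt) : Prop :=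
  HasDerivAt (fun t => f (Function.update x i t)) d (x i)

namespace HasPd

variable {i : Fin 4} {f g : Pt → ℝ} {d e : ℝ} {x : Pt}

theorem pd_eq (h : HasPd i f d x) : pd i f x = d := h.deriv

theorem congr (h : HasPd i f d x) (hd : d = e) : HasPd i f e x := hd ▸ h

theorem const (c : ℝ) : HasPd i (fun _ => c) 0 x := hasDerivAt_const _ _

theorem add (hf : HasPd i f d x) (hg : HasPd i g e x) :
    HasPd i (fun y => f y + g y) (d + e) x := HasDerivAt.add hf hg

theorem sub (hf : HasPd i f d x) (hg : HasPd i g e x) :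
    HasPd i (fun y => f y - g y) (d - e) x := HasDerivAt.sub hf hg

theorem neg (hf : HasPd i f d x) : HasPd i (fun y => -f y) (-d) x := HasDerivAt.neg hf

theorem mul (hf : HasPd i f d x) (hg : HasPd i g e x) :
    HasPd i (fun y => f y * g y) (d * g x + f x * e) x := by
  simpa [HasPd] using HasDerivAt.fun_mul hf hg

theorem pow (hf : HasPd i f d x) (n : ℕ) :
    HasPd i (fun y => f y ^ n) (n * f x ^ (n - 1) * d) x := by
  simpa [HasPd] using HasDerivAt.fun_pow hf n

theorem inv (hf : HasPd i f d x) (hx : f x ≠ 0) :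
    HasPd i (fun y => (f y)⁻¹) (-d * (f x)⁻¹ ^ 2) x := by
  have h := HasDerivAt.inv hf (by simpa using hx)
  simp only [Function.update_eq_self] at h
  exact h.congr_deriv (by rw [div_eq_mul_inv, inv_pow])

theorem comp_coord {F : ℝ → ℝ} (j : Fin 4) (hF : HasDerivAt F d (x j)) :
    HasPd i (fun y => F (y j)) (if i = j then d else 0) x := by
  unfold HasPd
  split_ifs with h
  · subst h; simpa using hF
  · simpa [Function.update_of_ne (Ne.symm h)] using hasDerivAt_const (x i) (F (x j))

/-- Closed forms of tensor components are available only on the coordinate domain; its openness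
makes them sufficient for differentiation. -/
theorem congr_of_isOpen {U : Set Pt} (hU : IsOpen U) (hx : x ∈ U) (hfg : ∀ y ∈ U, g y = f y)
    (h : HasPd i f d x) : HasPd i g d x := by
  refine HasDerivAt.congr_of_eventuallyEq h ?_
  have hc : ContinuousAt (fun t => Function.update x i t) (x i) :=
    (continuous_const.update i continuous_id).continuousAt
  have := hc.preimage_mem_nhds (by simpa using hU.mem_nhds hx)
  filter_upwards [this] with t ht using hfg _ ht

end HasPd

/-- A function on the chart that does not depend on the `i`-th coordinate. -/
def IndepOf (i : Fin 4) (f : Pt → ℝ) : Prop := ∀ x t, f (Function.update x i t) = f x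

namespace IndepOf

variable {i : Fin 4} {f : Pt → ℝ}

theorem hasPd (hf : IndepOf i f) (x : Pt) : HasPd i f 0 x := by
  unfold HasPd
  simpa only [hf x] using hasDerivAt_const (x i) (f x)

/-- Updates of distinct coordinates commute; for `j = i` the derivative is zero everywhere. -/
theorem pd (hf : IndepOf i f) (j : Fin 4) : IndepOf i (pd j f) := by
  intro x t
  by_cases h : j = i
  · subst h
    rw [(hf.hasPd _).pd_eq, (hf.hasPd _).pd_eq]
  · unfold Spacetime.pd
    simp only [Function.update_comm (Ne.symm h), hf _ _, Function.update_of_ne h]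

variable {g : Pt → Matrix (Fin 4) (Fin 4) ℝ}

theorem entry (hg : ∀ x t, g (Function.update x i t) = g x) (k l : Fin 4) :
    IndepOf i (fun y => g y k l) := fun x t => by simp only [hg]

theorem christoffel (hg : ∀ x t, g (Function.update x i t) = g x) (k l m : Fin 4) :
    IndepOf i (christoffel g k l m) := fun x t => by
  simp only [Spacetime.christoffel, hg, (entry hg _ _).pd _ x t]

theorem ricci (hg : ∀ x t, g (Function.update x i t) = g x) (k l : Fin 4) :
    IndepOf i (ricci g k l) := fun x t => by
  simp only [Spacetime.ricci, Spacetime.riemann, (christoffel hg _ _ _).pd _ x t,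
    christoffel hg _ _ _ x t]

theorem current (hg : ∀ x t, g (Function.update x i t) = g x) {X : Pt → Fin 4 → ℝ}
    (hX : ∀ x t, X (Function.update x i t) = X x) (k : Fin 4) :
    IndepOf i (fun y => current g X y k) := fun x t => by
  simp only [Spacetime.current, Spacetime.einsteinUp, Spacetime.einstein, Spacetime.lower,
    Spacetime.scalarCurvature, hg, hX, ricci hg _ _ x t]

end IndepOf

/-! ### Currents and Killing fields of coordinate vector fields -/

variable {g : Pt → Matrix (Fin 4) (Fin 4) ℝ} {x : Pt}

theorem sum_inv_mul (hg : (g x).IsSymm) (hdet : IsUnit (g x).det) (l k : Fin 4) :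
    ∑ j, (g x)⁻¹ j l * g x j k = if l = k then 1 else 0 := by
  have h := congrFun (congrFun (Matrix.mul_nonsing_inv (g x) hdet) k) l
  rw [Matrix.mul_apply, Matrix.one_apply] at h
  simp only [eq_comm (a := l), ← h]
  exact Finset.sum_congr rfl fun j _ => by rw [hg.apply, mul_comm]

/-- In terms of the mixed Ricci tensor, `Gⁱʲ gⱼₖ = gⁱˡ Rₗₖ - ½ R δⁱₖ`. -/
theorem current_single (hg : (g x).IsSymm) (hdet : IsUnit (g x).det) (i k : Fin 4) :
    current g (fun _ => Pi.single k 1) x i =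
      ∑ l, (g x)⁻¹ i l * ricci g l k x - 1 / 2 * scalarCurvature g x * if i = k then 1 else 0 := by
  have hL (j : Fin 4) : lower g (fun _ => Pi.single k 1) j x = g x j k := by
    simp [lower, Pi.single_apply]
  have h2 : ∑ l, (g x)⁻¹ i l * g x l k = if i = k then 1 else 0 := by
    have h := congrFun (congrFun (Matrix.nonsing_inv_mul (g x) hdet) i) k
    rwa [Matrix.mul_apply, Matrix.one_apply] at h
  calc current g (fun _ => Pi.single k 1) x i
      = ∑ j, ∑ m, ∑ l, (g x)⁻¹ i m * einstein g m l x * ((g x)⁻¹ j l * g x j k) := by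
        simp only [current, einsteinUp, hL, Finset.sum_mul]
        refine Finset.sum_congr rfl fun j _ => Finset.sum_congr rfl fun m _ =>
          Finset.sum_congr rfl fun l _ => by ring
    -- The sum over `j` contracts the metric with its inverse and leaves `δˡₖ`.
    _ = ∑ m, ∑ l, (g x)⁻¹ i m * einstein g m l x * ∑ j, (g x)⁻¹ j l * g x j k := by
        simp only [Finset.mul_sum]
        rw [Finset.sum_comm]
        exact Finset.sum_congr rfl fun m _ => Finset.sum_comm
    _ = ∑ m, (g x)⁻¹ i m * einstein g m k x := by simp [sum_inv_mul hg hdet]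
    _ = _ := by
        rw [← h2, Finset.mul_sum, ← Finset.sum_sub_distrib]
        exact Finset.sum_congr rfl fun m _ => by rw [einstein]; ring

/-- Lowering the upper index cancels the inverse metric, so the Killing equation needs no explicit
connection. -/
theorem sum_christoffel_mul (hg : (g x).IsSymm) (hdet : IsUnit (g x).det) (i j k : Fin 4) :
    ∑ m, christoffel g m i j x * g x m k = 1 / 2 * (pd i (fun y => g y j k) x +
      pd j (fun y => g y i k) x - pd k (fun y => g y i j) x) := by
  calc ∑ m, christoffel g m i j x * g x m k
      = ∑ l, 1 / 2 * (pd i (fun y => g y j l) x + pd j (fun y => g y i l) x -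
          pd l (fun y => g y i j) x) * ∑ m, (g x)⁻¹ m l * g x m k := by
        simp only [christoffel, Finset.mul_sum, Finset.sum_mul]
        rw [Finset.sum_comm]
        exact Finset.sum_congr rfl fun m _ => Finset.sum_congr rfl fun l _ => by ring
    _ = _ := by simp [sum_inv_mul hg hdet]

/-- A coordinate field is Killing if the metric does not depend on that coordinate. -/
theorem killingAt_single {k : Fin 4} (hg : ∀ x, (g x).IsSymm) (hdet : IsUnit (g x).det)
    (hk : ∀ x t, g (Function.update x k t) = g x) : KillingAt g (fun _ => Pi.single k 1) x := by
  have hL (j : Fin 4) : lower g (fun _ => Pi.single k 1) j = fun y => g y j k := by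
    funext y
    simp [lower, Pi.single_apply]
  have h0 (i j : Fin 4) : pd k (fun y => g y i j) x = 0 := ((IndepOf.entry hk i j).hasPd x).pd_eq
  intro i j
  -- With `∂ₖ g = 0`, `∇ᵢXⱼ = ½(∂ᵢ gⱼₖ - ∂ⱼ gᵢₖ)`, which is antisymmetric.
  simp only [covDerivCovector, hL, sum_christoffel_mul (hg x) hdet, h0]
  ring

end Spacetime

namespace KerrVaidya

open Spacetime

/-! ### The components of the metric and of its connection as polynomials

The variables are `a`, `r`, `s = sin ϑ`, `c = cos ϑ`, `u = 1 / ρ²`, `q = 1 / sin ϑ`,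
`h = M(v) r / ρ²`, `k = -∂h/∂r` and `n = ∂h/∂v`. -/

/-- The components `gᵢⱼ` of the metric. -/
def metricPoly (a r s c h : ℝ) : Matrix (Fin 4) (Fin 4) ℝ :=
  !![2 * h - 1, 1, 0, -(2 * a * s ^ 2 * h);
    1, 0, 0, -(a * s ^ 2);
    0, 0, r ^ 2 + a ^ 2 * c ^ 2, 0;
    -(2 * a * s ^ 2 * h), -(a * s ^ 2), 0, s ^ 2 * (r ^ 2 + a ^ 2 + 2 * a ^ 2 * s ^ 2 * h)]

/-- The components `gⁱʲ` of the inverse metric. -/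
def invPoly (a r s u q h : ℝ) : Matrix (Fin 4) (Fin 4) ℝ :=
  !![a ^ 2 * s ^ 2 * u, (r ^ 2 + a ^ 2) * u, 0, a * u;
    (r ^ 2 + a ^ 2) * u, (r ^ 2 + a ^ 2) * u - 2 * h, 0, a * u;
    0, 0, u, 0;
    a * u, a * u, 0, u * q ^ 2]

/-- The partial derivatives `∂ᵢ gⱼₖ`. -/
def dmetricPoly (a r s c u h k n : ℝ) : Fin 4 → Matrix (Fin 4) (Fin 4) ℝ
  | 0 => !![2 * n, 0, 0, -(2 * a * s ^ 2 * n);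
      0, 0, 0, 0;
      0, 0, 0, 0;
      -(2 * a * s ^ 2 * n), 0, 0, 2 * a ^ 2 * s ^ 4 * n]
  | 1 => !![-(2 * k), 0, 0, 2 * a * s ^ 2 * k;
      0, 0, 0, 0;
      0, 0, 2 * r, 0;
      2 * a * s ^ 2 * k, 0, 0, 2 * s ^ 2 * (r - a ^ 2 * s ^ 2 * k)]
  | 2 => !![4 * a ^ 2 * s * c * u * h, 0, 0, -(4 * a * s * c * h * (1 + a ^ 2 * s ^ 2 * u));
      0, 0, 0, -(2 * a * s * c);
      0, 0, -(2 * a ^ 2 * s * c), 0;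
      -(4 * a * s * c * h * (1 + a ^ 2 * s ^ 2 * u)), -(2 * a * s * c), 0,
        2 * s * c * (r ^ 2 + a ^ 2 + 4 * a ^ 2 * s ^ 2 * h + 2 * a ^ 4 * s ^ 4 * u * h)]
  | 3 => 0

/-- The Christoffel symbols `Γᵏᵢⱼ`; here `e = (r² + a²) / ρ²` and `p = Γ⁰₀₀`. -/
def connectionPoly (a r s c u q h k n e p : ℝ) : Fin 4 → Matrix (Fin 4) (Fin 4) ℝ
  | 0 => !![p, 0, -(2 * a ^ 2 * s * c * u * h), -(a * s ^ 2 * p);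
      0, 0, -(a ^ 2 * s * c * u), a * r * s ^ 2 * u;
      -(2 * a ^ 2 * s * c * u * h), -(a ^ 2 * s * c * u), -(r * e), 2 * a ^ 3 * s ^ 3 * c * u * h;
      -(a * s ^ 2 * p), a * r * s ^ 2 * u, 2 * a ^ 3 * s ^ 3 * c * u * h,
        a ^ 2 * s ^ 4 * p - r * s ^ 2 * e]
  | 1 => !![p + n - 2 * h * k, -k, 0, -(a * s ^ 2 * (p - 2 * h * k));
      -k, 0, -(a ^ 2 * s * c * u), a * s ^ 2 * (k + r * u);
      0, -(a ^ 2 * s * c * u), 2 * r * h - r * e, 0;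
      -(a * s ^ 2 * (p - 2 * h * k)), a * s ^ 2 * (k + r * u), 0,
        a ^ 2 * s ^ 4 * (p - n - 2 * h * k) - r * s ^ 2 * e + 2 * r * s ^ 2 * h]
  | 2 => !![-(2 * a ^ 2 * s * c * u ^ 2 * h), 0, 0, 2 * a * s * c * u * e * h;
      0, 0, r * u, a * s * c * u;
      0, r * u, -(a ^ 2 * s * c * u), 0;
      2 * a * s * c * u * e * h, a * s * c * u, 0,
        -(s * c * e) - 2 * a ^ 2 * s ^ 3 * c * u * h * (1 + e)]
  | 3 => !![a * u * (k - n), 0, -(2 * a * c * u * q * h), -(a ^ 2 * s ^ 2 * u * (k - n));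
      0, 0, -(a * c * u * q), r * u;
      -(2 * a * c * u * q * h), -(a * c * u * q), -(a * r * u), c * q + 2 * a ^ 2 * s * c * u * h;
      -(a ^ 2 * s ^ 2 * u * (k - n)), r * u, c * q + 2 * a ^ 2 * s * c * u * h,
        a ^ 3 * s ^ 4 * u * (k - n) - a * r * s ^ 2 * u]

theorem forall_fin_four {P : Fin 4 → Prop} (h0 : P 0) (h1 : P 1) (h2 : P 2) (h3 : P 3) :
    ∀ i, P i := by
  intro i; fin_cases i <;> assumption

theorem metricPoly_mul_invPoly {a r s c u q h : ℝ} (h1 : s ^ 2 + c ^ 2 = 1)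
    (h2 : u * (r ^ 2 + a ^ 2 * c ^ 2) = 1) (h3 : s * q = 1) :
    metricPoly a r s c h * invPoly a r s u q h = 1 := by
  refine Matrix.ext (forall_fin_four ?_ ?_ ?_ ?_) <;> refine forall_fin_four ?_ ?_ ?_ ?_ <;>
    simp [metricPoly, invPoly, Matrix.mul_apply, Fin.sum_univ_four] <;> grind

/-- Here `h`, `k`, `n` are independent symbols: the identity needs no relation between the potential
and its derivatives. -/
theorem christoffel_poly {a r s c u q h k n e p : ℝ} (h1 : s ^ 2 + c ^ 2 = 1)
    (h2 : u * (r ^ 2 + a ^ 2 * c ^ 2) = 1) (h3 : s * q = 1) (he : e = (r ^ 2 + a ^ 2) * u)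
    (hp : p = k + a ^ 2 * s ^ 2 * u * (k - n)) : ∀ l i j : Fin 4,
    1 / 2 * ∑ m, invPoly a r s u q h l m * (dmetricPoly a r s c u h k n i j m +
      dmetricPoly a r s c u h k n j i m - dmetricPoly a r s c u h k n m i j) =
    connectionPoly a r s c u q h k n e p l i j := by
  subst he hp
  refine forall_fin_four ?_ ?_ ?_ ?_ <;> refine forall_fin_four ?_ ?_ ?_ ?_ <;>
    refine forall_fin_four ?_ ?_ ?_ ?_ <;>
      simp [dmetricPoly, invPoly, connectionPoly, Fin.sum_univ_four] <;> grind

/-! ### The connection of the Kerr-Vaidya metric -/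

/-- `u = 1 / ρ²`. -/
def invRhoSq (a : ℝ) (x : Pt) : ℝ := (rhoSq a x)⁻¹

/-- `h = M(v) r / ρ²`. -/
def potential (M : ℝ → ℝ) (a : ℝ) (x : Pt) : ℝ := M (x 0) * x 1 * invRhoSq a x

/-- `n = ∂h/∂v`. -/
def potentialV (M : ℝ → ℝ) (a : ℝ) (x : Pt) : ℝ := deriv M (x 0) * x 1 * invRhoSq a x

/-- `k = -∂h/∂r`. -/
def potentialR (M : ℝ → ℝ) (a : ℝ) (x : Pt) : ℝ :=
  M (x 0) * (invRhoSq a x * (2 * x 1 ^ 2 * invRhoSq a x - 1))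

/-- `e = (r² + a²) / ρ²`. -/
def ratio (a : ℝ) (x : Pt) : ℝ := (x 1 ^ 2 + a ^ 2) * invRhoSq a x

/-- `p = k + a² sin² ϑ (k - n) / ρ²`. -/
def acceleration (M : ℝ → ℝ) (a : ℝ) (x : Pt) : ℝ :=
  potentialR M a x +
    a ^ 2 * sin (x 2) ^ 2 * invRhoSq a x * (potentialR M a x - potentialV M a x)

/-- The Christoffel symbols of the Kerr-Vaidya metric in closed form. -/
def connection (M : ℝ → ℝ) (a : ℝ) (l i j : Fin 4) (x : Pt) : ℝ :=
  connectionPoly a (x 1) (sin (x 2)) (cos (x 2)) (invRhoSq a x) (sin (x 2))⁻¹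
    (potential M a x) (potentialR M a x) (potentialV M a x) (ratio a x) (acceleration M a x) l i j

variable {M : ℝ → ℝ} {a : ℝ} {x : Pt}

theorem isOpen_domain : IsOpen domain := by
  refine IsOpen.and ?_ (IsOpen.and ?_ ?_)
  · exact isOpen_lt continuous_const (continuous_apply 1)
  · exact isOpen_Ioo.preimage (continuous_apply 2)
  · exact isOpen_Ioo.preimage (continuous_apply 3)

theorem rhoSq_pos (hx : x ∈ domain) : 0 < rhoSq a x := by
  have := hx.1
  unfold rhoSq
  positivity

theorem sin_pos (hx : x ∈ domain) : 0 < sin (x 2) := sin_pos_of_mem_Ioo hx.2.1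

theorem invRhoSq_mul (hx : x ∈ domain) :
    invRhoSq a x * (x 1 ^ 2 + a ^ 2 * cos (x 2) ^ 2) = 1 := inv_mul_cancel₀ (rhoSq_pos hx).ne'

/-- For the last entry, `ρ² = Γ - a² sin² ϑ` and `Δ = Γ - 2 M r` give `Γ² - Δ a² sin² ϑ = Γ ρ² + 2 M
r a² sin² ϑ`, so the division by `ρ²` leaves a polynomial in `h`. -/
theorem metric_eq (hx : x ∈ domain) : metric M a x =
    metricPoly a (x 1) (sin (x 2)) (cos (x 2)) (potential M a x) := by
  have h1 := sin_sq_add_cos_sq (x 2)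
  have h2 := invRhoSq_mul (a := a) hx
  have h3 : rhoSq a x = x 1 ^ 2 + a ^ 2 * cos (x 2) ^ 2 := rfl
  refine Matrix.ext (forall_fin_four ?_ ?_ ?_ ?_) <;> refine forall_fin_four ?_ ?_ ?_ ?_ <;>
    simp [metric, metricPoly, div_eq_mul_inv, potential, Gam, Del, -mul_eq_mul_left_iff,
      -mul_eq_mul_right_iff, ← invRhoSq.eq_1] <;> grind

theorem inv_metric_eq (hx : x ∈ domain) : (metric M a x)⁻¹ =
    invPoly a (x 1) (sin (x 2)) (invRhoSq a x) (sin (x 2))⁻¹ (potential M a x) := by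
  rw [metric_eq hx]
  exact Matrix.inv_eq_right_inv (metricPoly_mul_invPoly (sin_sq_add_cos_sq _)
    (invRhoSq_mul hx) (mul_inv_cancel₀ (sin_pos hx).ne'))

theorem isUnit_det_metric (hx : x ∈ domain) : IsUnit (metric M a x).det := by
  rw [metric_eq hx]
  exact Matrix.isUnit_det_of_right_inverse (metricPoly_mul_invPoly (sin_sq_add_cos_sq _)
    (invRhoSq_mul hx) (mul_inv_cancel₀ (sin_pos hx).ne'))

theorem isSymm_metric (x : Pt) : (metric M a x).IsSymm := by
  refine Matrix.IsSymm.ext (forall_fin_four ?_ ?_ ?_ ?_) <;>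
    refine forall_fin_four ?_ ?_ ?_ ?_ <;> rfl

theorem metric_update_three (x : Pt) (t : ℝ) :
    metric M a (Function.update x 3 t) = metric M a x := by
  simp [metric, rhoSq, Gam, Del]

/-! ### Partial derivatives of the building blocks and of the metric -/

section partial_derivatives

variable {i : Fin 4}

theorem hasPd_r : HasPd i (fun y => y 1) (if i = 1 then 1 else 0) x :=
  HasPd.comp_coord (F := fun t => t) 1 (hasDerivAt_id _)

theorem hasPd_sin : HasPd i (fun y => sin (y 2)) (if i = 2 then cos (x 2) else 0) x :=
  HasPd.comp_coord 2 (hasDerivAt_sin _)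

theorem hasPd_cos : HasPd i (fun y => cos (y 2)) (if i = 2 then -sin (x 2) else 0) x :=
  HasPd.comp_coord 2 (hasDerivAt_cos _)

theorem hasPd_mass (hM : Differentiable ℝ M) :
    HasPd i (fun y => M (y 0)) (if i = 0 then deriv M (x 0) else 0) x :=
  HasPd.comp_coord 0 (hM _).hasDerivAt

theorem hasPd_invRhoSq (hx : x ∈ domain) : HasPd i (invRhoSq a)
    (if i = 1 then -2 * x 1 * invRhoSq a x ^ 2 else
      if i = 2 then 2 * a ^ 2 * sin (x 2) * cos (x 2) * invRhoSq a x ^ 2 else 0) x := by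
  refine (HasPd.inv (f := rhoSq a) (((hasPd_r).pow 2).add ((HasPd.const _).mul
    ((hasPd_cos).pow 2))) (rhoSq_pos hx).ne').congr ?_
  rw [← invRhoSq]
  revert i
  refine @forall_fin_four _ ?_ ?_ ?_ ?_ <;>
    simp [-mul_eq_mul_right_iff, -mul_eq_mul_left_iff] <;> ring

theorem hasPd_potential (hM : Differentiable ℝ M) (hx : x ∈ domain) : HasPd i (potential M a)
    (if i = 0 then potentialV M a x else if i = 1 then -potentialR M a x else
      if i = 2 then 2 * a ^ 2 * sin (x 2) * cos (x 2) * invRhoSq a x * potential M a x else 0)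
    x := by
  refine (((hasPd_mass hM).mul hasPd_r).mul (hasPd_invRhoSq hx)).congr ?_
  revert i
  refine @forall_fin_four _ ?_ ?_ ?_ ?_ <;> simp [potential, potentialV, potentialR] <;> ring

/-- By definition `potentialV M a` is `potential (deriv M) a`. -/
theorem hasPd_potentialV (hM : Differentiable ℝ (deriv M)) (hx : x ∈ domain) :
    HasPd i (potentialV M a)
    (if i = 0 then deriv (deriv M) (x 0) * x 1 * invRhoSq a x else
      if i = 1 then -(deriv M (x 0) * (invRhoSq a x * (2 * x 1 ^ 2 * invRhoSq a x - 1))) else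
      if i = 2 then 2 * a ^ 2 * sin (x 2) * cos (x 2) * invRhoSq a x * potentialV M a x else 0)
    x :=
  hasPd_potential hM hx

theorem hasPd_potentialR (hM : Differentiable ℝ M) (hx : x ∈ domain) : HasPd i (potentialR M a)
    (if i = 0 then deriv M (x 0) * (invRhoSq a x * (2 * x 1 ^ 2 * invRhoSq a x - 1)) else
      if i = 1 then
        2 * M (x 0) * x 1 * invRhoSq a x ^ 2 * (3 - 4 * x 1 ^ 2 * invRhoSq a x) else
      if i = 2 then 2 * a ^ 2 * sin (x 2) * cos (x 2) * invRhoSq a x ^ 2 * M (x 0) *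
        (4 * x 1 ^ 2 * invRhoSq a x - 1) else 0) x := by
  refine ((hasPd_mass hM).mul ((hasPd_invRhoSq hx).mul ((((HasPd.const 2).mul
    (hasPd_r.pow 2)).mul (hasPd_invRhoSq hx)).sub (HasPd.const 1)))).congr ?_
  revert i
  refine @forall_fin_four _ ?_ ?_ ?_ ?_ <;> simp <;> ring

theorem hasPd_ratio (hx : x ∈ domain) : HasPd i (ratio a)
    (if i = 1 then 2 * x 1 * invRhoSq a x * (1 - ratio a x) else
      if i = 2 then 2 * a ^ 2 * sin (x 2) * cos (x 2) * invRhoSq a x * ratio a x else 0) x := by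
  refine (((hasPd_r.pow 2).add (HasPd.const _)).mul (hasPd_invRhoSq hx)).congr ?_
  revert i
  refine @forall_fin_four _ ?_ ?_ ?_ ?_ <;> simp [ratio] <;> ring

theorem hasPd_metricPoly (hM : Differentiable ℝ M) (hx : x ∈ domain) : ∀ i j l : Fin 4,
    HasPd i (fun y => metricPoly a (y 1) (sin (y 2)) (cos (y 2)) (potential M a y) j l)
      (dmetricPoly a (x 1) (sin (x 2)) (cos (x 2)) (invRhoSq a x) (potential M a x)
        (potentialR M a x) (potentialV M a x) i j l) x := by
  intro i
  refine forall_fin_four ?_ ?_ ?_ ?_ <;> refine forall_fin_four ?_ ?_ ?_ ?_ <;>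
    simp only [metricPoly, Matrix.of_apply, Matrix.cons_val] <;>
    -- The derivative is first a metavariable, assembled by the differentiation rules, and is then
    -- compared with the table.
    (apply HasPd.congr
     · repeat' first
        | exact HasPd.const _ | exact hasPd_r | exact hasPd_sin | exact hasPd_cos
        | exact hasPd_potential hM hx | apply HasPd.pow | apply HasPd.neg | apply HasPd.add
        | apply HasPd.sub | apply HasPd.mul
     · revert i
       refine @forall_fin_four _ ?_ ?_ ?_ ?_ <;> simp [dmetricPoly] <;> ring)

end partial_derivatives

theorem christoffel_eq (hM : Differentiable ℝ M) (hx : x ∈ domain) (l i j : Fin 4) :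
    christoffel (metric M a) l i j x = connection M a l i j x := by
  have h (i j l : Fin 4) : pd i (fun y => metric M a y j l) x = dmetricPoly a (x 1) (sin (x 2))
      (cos (x 2)) (invRhoSq a x) (potential M a x) (potentialR M a x) (potentialV M a x) i j l :=
    (HasPd.congr_of_isOpen isOpen_domain hx
    (fun y hy => by rw [metric_eq hy]) (hasPd_metricPoly (a := a) hM hx i j l)).pd_eq
  simp only [christoffel, h, inv_metric_eq hx]
  exact christoffel_poly (sin_sq_add_cos_sq _) (invRhoSq_mul hx)
    (mul_inv_cancel₀ (sin_pos hx).ne') rfl rfl l i j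

/-! ### The Ricci tensor in the axial direction -/

/-- The components `Rₗ₃` of the Ricci tensor. -/
def ricciPoly (a r s c u m1 m2 : ℝ) : Fin 4 → ℝ
  | 0 => a ^ 3 * r * s ^ 4 * u ^ 2 * m2 - a * s ^ 2 * u * m1 * (3 - 4 * a ^ 2 * u +
      6 * a ^ 2 * s ^ 2 * u - 4 * a ^ 4 * s ^ 2 * c ^ 2 * u ^ 2)
  | 1 => 0
  | 2 => 2 * a ^ 3 * r * s ^ 3 * c * u ^ 2 * m1
  | 3 => a ^ 2 * s ^ 4 * u * m1 * (4 - 6 * a ^ 2 * u + 8 * a ^ 2 * s ^ 2 * u -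
      4 * a ^ 4 * s ^ 2 * c ^ 2 * u ^ 2) - a ^ 4 * r * s ^ 6 * u ^ 2 * m2

/-- The derivatives `∂ₖ Γᵏ₃ₗ` (no summation), where `dk i = ∂ᵢ k`, `dn i = ∂ᵢ n`. -/
def dconnectionPoly (a r s c u h k n e : ℝ) (dk dn : Fin 4 → ℝ) : Fin 4 → Fin 4 → ℝ
  | 0 => ![-(a * s ^ 2 * (dk 0 + a ^ 2 * s ^ 2 * u * (dk 0 - dn 0))), 0,
      2 * a ^ 3 * s ^ 3 * c * u * n,
      a ^ 2 * s ^ 4 * (dk 0 + a ^ 2 * s ^ 2 * u * (dk 0 - dn 0))]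
  | 1 => ![-(a * s ^ 2 * (dk 1 + a ^ 2 * s ^ 2 * u * (dk 1 - dn 1 - 2 * r * u * (k - n)) +
        2 * k ^ 2 - 2 * h * dk 1)),
      a * s ^ 2 * (dk 1 + u - 2 * r ^ 2 * u ^ 2), 0,
      a ^ 2 * s ^ 4 * (dk 1 + a ^ 2 * s ^ 2 * u * (dk 1 - dn 1 - 2 * r * u * (k - n)) - dn 1 +
        2 * k ^ 2 - 2 * h * dk 1) - s ^ 2 * (e + 2 * r ^ 2 * u * (1 - e)) + 2 * s ^ 2 * (h - r * k)]
  | 2 => ![2 * a * u * e * h * (c ^ 2 - s ^ 2 + 6 * a ^ 2 * s ^ 2 * c ^ 2 * u),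
      a * u * (c ^ 2 - s ^ 2 + 2 * a ^ 2 * s ^ 2 * c ^ 2 * u), 0,
      -(e * (c ^ 2 - s ^ 2 + 2 * a ^ 2 * s ^ 2 * c ^ 2 * u)) - 2 * a ^ 2 * u * h * s ^ 2 *
        ((3 * c ^ 2 - s ^ 2) * (1 + e) + 4 * a ^ 2 * s ^ 2 * c ^ 2 * u * (1 + e) +
          2 * a ^ 2 * s ^ 2 * c ^ 2 * u * e)]
  | 3 => 0

/-- `m0`, `m1`, `m2` stand for `M`, `M'`, `M''`. For constant `M` the metric is Kerr, which is Ricci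
flat; accordingly `m0` cancels. Only the `v`- and `r`-derivatives of `k` and `n` occur, since `Γ²ᵢⱼ`
contains neither. -/
theorem ricci_poly {a r s c u q h k n e p m0 m1 m2 : ℝ} {dk dn : Fin 4 → ℝ}
    (h1 : s ^ 2 + c ^ 2 = 1)
    (h2 : u * (r ^ 2 + a ^ 2 * c ^ 2) = 1) (h3 : s * q = 1) (he : e = (r ^ 2 + a ^ 2) * u)
    (hp : p = k + a ^ 2 * s ^ 2 * u * (k - n)) (hh : h = m0 * r * u) (hn : n = m1 * r * u)
    (hk : k = m0 * (u * (2 * r ^ 2 * u - 1)))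
    (hdk0 : dk 0 = m1 * (u * (2 * r ^ 2 * u - 1)))
    (hdk1 : dk 1 = 2 * m0 * r * u ^ 2 * (3 - 4 * r ^ 2 * u))
    (hdn0 : dn 0 = m2 * r * u)
    (hdn1 : dn 1 = -(m1 * (u * (2 * r ^ 2 * u - 1)))) : ∀ l : Fin 4,
    ∑ i, (dconnectionPoly a r s c u h k n e dk dn i l +
      ∑ j, (connectionPoly a r s c u q h k n e p i i j * connectionPoly a r s c u q h k n e p j 3 l -
        connectionPoly a r s c u q h k n e p i 3 j * connectionPoly a r s c u q h k n e p j i l)) =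
    ricciPoly a r s c u m1 m2 l := by
  refine forall_fin_four ?_ ?_ ?_ ?_ <;>
    simp [dconnectionPoly, ricciPoly, connectionPoly, Fin.sum_univ_four, hdk0, hdk1, hdn0, hdn1]
  · subst he hp hh hk hn
    grind
  · subst he hp hh hk hn
    grind
  · subst he hp hh hk hn
    grind
  · subst he hp hh hk hn
    grind

/-- The partial derivatives of `k`. -/
def dpotentialR (M : ℝ → ℝ) (a : ℝ) (x : Pt) : Fin 4 → ℝ := fun i => pd i (potentialR M a) x

/-- The partial derivatives of `n`. -/
def dpotentialV (M : ℝ → ℝ) (a : ℝ) (x : Pt) : Fin 4 → ℝ := fun i => pd i (potentialV M a) x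

theorem hasPd_connection (hM : Differentiable ℝ M) (hM' : Differentiable ℝ (deriv M))
    (hx : x ∈ domain) : ∀ i l : Fin 4, HasPd i (connection M a i 3 l)
      (dconnectionPoly a (x 1) (sin (x 2)) (cos (x 2)) (invRhoSq a x) (potential M a x)
        (potentialR M a x) (potentialV M a x) (ratio a x) (dpotentialR M a x)
        (dpotentialV M a x) i l) x := by
  have hk (i : Fin 4) : HasPd i (potentialR M a) (dpotentialR M a x i) x :=
    (hasPd_potentialR hM hx).congr (hasPd_potentialR hM hx).pd_eq.symm
  have hn (i : Fin 4) : HasPd i (potentialV M a) (dpotentialV M a x i) x :=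
    (hasPd_potentialV hM' hx).congr (hasPd_potentialV hM' hx).pd_eq.symm
  have h3 (l : Fin 4) : IndepOf 3 (connection M a 3 3 l) := fun x t => by
    simp [connection, invRhoSq, rhoSq, potential, potentialR, potentialV, ratio, acceleration]
  refine forall_fin_four ?_ ?_ ?_ fun l => (h3 l).hasPd x <;>
    refine forall_fin_four ?_ ?_ ?_ ?_ <;>
    (unfold connection
     simp only [connectionPoly, acceleration, Matrix.of_apply, Matrix.cons_val]
     apply HasPd.congr
     · repeat' first
        | exact HasPd.const _ | exact hasPd_r | exact hasPd_sin | exact hasPd_cos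
        | exact hasPd_potential hM hx | exact hk _ | exact hn _ | exact hasPd_invRhoSq hx
        | exact hasPd_ratio hx | apply HasPd.pow | apply HasPd.neg | apply HasPd.add
        | apply HasPd.sub | apply HasPd.mul
     · simp [dconnectionPoly, -mul_eq_mul_left_iff, -mul_eq_mul_right_iff] <;> ring)

theorem ricci_eq (hM : Differentiable ℝ M) (hM' : Differentiable ℝ (deriv M)) (hx : x ∈ domain)
    (l : Fin 4) : ricci (metric M a) l 3 x = ricciPoly a (x 1) (sin (x 2)) (cos (x 2))
      (invRhoSq a x) (deriv M (x 0)) (deriv (deriv M) (x 0)) l := by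
  have h1 (i : Fin 4) := (HasPd.congr_of_isOpen isOpen_domain hx
    (fun y hy => christoffel_eq (a := a) hM hy i 3 l) (hasPd_connection hM hM' hx i l)).pd_eq
  -- The term `∂₃ Γⁱᵢₗ` of `Rₗ₃` vanishes by axial symmetry, so only the derivatives `∂ᵢ Γⁱ₃ₗ`
  -- remain.
  have h2 (i : Fin 4) : pd 3 (christoffel (metric M a) i i l) x = 0 :=
    ((IndepOf.christoffel metric_update_three i i l).hasPd x).pd_eq
  simp only [ricci, riemann, h1, h2, christoffel_eq hM hx, sub_zero]
  exact ricci_poly (sin_sq_add_cos_sq _) (invRhoSq_mul hx) (mul_inv_cancel₀ (sin_pos hx).ne')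
    rfl rfl rfl rfl rfl (hasPd_potentialR hM hx).pd_eq (hasPd_potentialR hM hx).pd_eq
    (hasPd_potentialV hM' hx).pd_eq (hasPd_potentialV hM' hx).pd_eq l

/-! ### The axial current -/

/-- The components `I⁰`, `I¹`, `I²` of the axial current. -/
def currentPoly (a r s c u m1 m2 : ℝ) : Fin 4 → ℝ
  | 0 => a ^ 3 * s ^ 4 * u ^ 2 * m1 * (1 - 2 * a ^ 2 * c ^ 2 * u)
  | 1 => a * s ^ 2 * u * m1 * (-3 + 4 * a ^ 2 * u - 5 * a ^ 2 * s ^ 2 * u +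
      2 * a ^ 4 * s ^ 2 * c ^ 2 * u ^ 2) + a ^ 3 * r * s ^ 4 * u ^ 2 * m2
  | 2 => 2 * a ^ 3 * r * s ^ 3 * c * u ^ 3 * m1
  | 3 => 0

/-- The last entry of `currentPoly` is a placeholder, whence `i ≠ 3`; for the other `i` the scalar
curvature term is absent from `Iⁱ`. -/
theorem current_poly {a r s c u q h m1 m2 : ℝ} (h1 : s ^ 2 + c ^ 2 = 1)
    (h2 : u * (r ^ 2 + a ^ 2 * c ^ 2) = 1) : ∀ i : Fin 4, i ≠ 3 →
    ∑ l, invPoly a r s u q h i l * ricciPoly a r s c u m1 m2 l = currentPoly a r s c u m1 m2 i := by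
  refine forall_fin_four ?_ ?_ ?_ ?_ <;> intro hi <;>
    simp [invPoly, ricciPoly, currentPoly, Fin.sum_univ_four] at hi ⊢ <;> grind

theorem axialCurrent_eq (hM : Differentiable ℝ M) (hM' : Differentiable ℝ (deriv M))
    (hx : x ∈ domain) {i : Fin 4} (hi : i ≠ 3) : axialCurrent M a x i =
      currentPoly a (x 1) (sin (x 2)) (cos (x 2)) (invRhoSq a x) (deriv M (x 0))
        (deriv (deriv M) (x 0)) i := by
  unfold axialCurrent axial
  rw [current_single (isSymm_metric x) (isUnit_det_metric hx), if_neg hi, mul_zero, sub_zero]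
  simp only [ricci_eq hM hM' hx, inv_metric_eq hx]
  exact current_poly (sin_sq_add_cos_sq _) (invRhoSq_mul hx) i hi

/-- These are the derivatives `∂ⱼ log √(-det g)` with `√(-det g) = ρ² sin ϑ`. -/
theorem connection_trace (hx : x ∈ domain) : ∀ j : Fin 4, ∑ i, connection M a i i j x =
    ![0, 2 * x 1 * invRhoSq a x,
      cos (x 2) * (sin (x 2))⁻¹ - 2 * a ^ 2 * sin (x 2) * cos (x 2) * invRhoSq a x, 0] j := by
  have h1 := sin_sq_add_cos_sq (x 2)
  have h2 := invRhoSq_mul (a := a) hx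
  have h3 := mul_inv_cancel₀ (sin_pos hx).ne'
  refine forall_fin_four ?_ ?_ ?_ ?_ <;>
    simp [connection, connectionPoly, acceleration, Fin.sum_univ_four] <;> grind

/-- The derivatives `∂ᵢ Iⁱ` (no summation). -/
def dcurrentPoly (a r s c u m1 m2 : ℝ) : Fin 4 → ℝ
  | 0 => a ^ 3 * s ^ 4 * u ^ 2 * m2 * (1 - 2 * a ^ 2 * c ^ 2 * u)
  | 1 => -2 * r * u ^ 2 * (a * s ^ 2 * m1 * (-3 + 8 * a ^ 2 * u - 10 * a ^ 2 * s ^ 2 * u +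
      6 * a ^ 4 * s ^ 2 * c ^ 2 * u ^ 2)) + a ^ 3 * s ^ 4 * u ^ 2 * m2 * (1 - 4 * r ^ 2 * u)
  | 2 => 2 * a ^ 3 * r * s ^ 2 * u ^ 3 * m1 * (3 * c ^ 2 - s ^ 2 + 6 * a ^ 2 * s ^ 2 * c ^ 2 * u)
  | 3 => 0

/-- No third derivative of `M` is needed: only `I⁰` is differentiated in `v`, and it involves `M'`
but not `M''`. -/
theorem hasPd_axialCurrent (hM : Differentiable ℝ M) (hM' : Differentiable ℝ (deriv M))
    (hx : x ∈ domain) : ∀ i : Fin 4, HasPd i (fun y => axialCurrent M a y i)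
      (dcurrentPoly a (x 1) (sin (x 2)) (cos (x 2)) (invRhoSq a x) (deriv M (x 0))
        (deriv (deriv M) (x 0)) i) x := by
  have h0 : HasPd 0 (fun y => deriv M (y 0)) _ x := hasPd_mass hM'
  have hV {i : Fin 4} (hi : i ≠ 0) {f : ℝ → ℝ} : HasPd i (fun y => f (y 0)) 0 x :=
    IndepOf.hasPd (fun y t => by rw [Function.update_of_ne hi.symm]) x
  refine forall_fin_four ?_ ?_ ?_ ((IndepOf.current metric_update_three (fun _ _ => rfl) 3).hasPd x)
  all_goals
    refine HasPd.congr_of_isOpen isOpen_domain hx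
      (fun y hy => axialCurrent_eq hM hM' hy (by decide)) ?_
    simp only [currentPoly]
    apply HasPd.congr
    · repeat' first
        | exact HasPd.const _ | exact hasPd_r | exact hasPd_sin | exact hasPd_cos | exact h0
        | exact hV (f := deriv M) (by decide) | exact hV (f := deriv (deriv M)) (by decide)
        | exact hasPd_invRhoSq hx | apply HasPd.pow | apply HasPd.neg | apply HasPd.add
        | apply HasPd.sub | apply HasPd.mul
    · simp [dcurrentPoly, -mul_eq_mul_left_iff, -mul_eq_mul_right_iff] <;> ring

theorem conservedAt_axialCurrent (hM : Differentiable ℝ M) (hM' : Differentiable ℝ (deriv M))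
    (hx : x ∈ domain) : ConservedAt (metric M a) (axialCurrent M a) x := by
  have hI := hasPd_axialCurrent (a := a) hM hM' hx
  refine ⟨fun i => (hI i).differentiableAt, ?_⟩
  have h1 := sin_sq_add_cos_sq (x 2)
  have h2 := invRhoSq_mul (a := a) hx
  have h3 := mul_inv_cancel₀ (sin_pos hx).ne'
  have hi := connection_trace (M := M) (a := a) hx
  simp only [divergence, (hI _).pd_eq, christoffel_eq hM hx, Finset.sum_add_distrib]
  -- Exchanging the sums produces the trace `Γⁱᵢⱼ`, whose entry at `j = 3` is zero and removes the
  -- unknown `I³`.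
  rw [Finset.sum_comm]
  simp only [← Finset.sum_mul, hi]
  simp [Fin.sum_univ_four, axialCurrent_eq hM hM' hx, dcurrentPoly, currentPoly]
  grind

/-! ### The charge -/

theorem det_metricPoly {a r s c h : ℝ} (h1 : s ^ 2 + c ^ 2 = 1) :
    (metricPoly a r s c h).det = -((r ^ 2 + a ^ 2 * c ^ 2) * s) ^ 2 := by
  rw [show r ^ 2 + a ^ 2 * c ^ 2 = r ^ 2 + a ^ 2 - a ^ 2 * s ^ 2 by grind]
  simp [metricPoly, Matrix.det_succ_row_zero, Fin.sum_univ_succ, Fin.succAbove]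
  grind

theorem sqrt_neg_det_metric {M : ℝ → ℝ} {a : ℝ} {x : Pt} (hx : x ∈ domain) :
    √(-(metric M a x).det) = rhoSq a x * sin (x 2) := by
  rw [metric_eq hx, det_metricPoly (sin_sq_add_cos_sq _), neg_neg]
  exact sqrt_sq (mul_pos (rhoSq_pos hx) (sin_pos hx)).le

/-- The coefficient of `M'` in the flux density. -/
def fluxA (a r θ : ℝ) : ℝ :=
  -3 * a * sin θ ^ 3 + a ^ 3 * (4 * sin θ ^ 3 - 5 * sin θ ^ 5) * (r ^ 2 + a ^ 2 * cos θ ^ 2)⁻¹ +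
    2 * a ^ 5 * sin θ ^ 5 * cos θ ^ 2 * (r ^ 2 + a ^ 2 * cos θ ^ 2)⁻¹ ^ 2

/-- The coefficient of `M''` in the flux density. -/
def fluxB (a r θ : ℝ) : ℝ := a ^ 3 * r * sin θ ^ 5 * (r ^ 2 + a ^ 2 * cos θ ^ 2)⁻¹

variable {r : ℝ}

/-- The factor `ρ²` of the volume density cancels one power of `u`, and the variables `w` and `ϑ`
separate. -/
theorem fluxDensity_eq (hM : Differentiable ℝ M) (hM' : Differentiable ℝ (deriv M)) (hr : 0 < r)
    {v₀ v : ℝ} {p : ℝ × ℝ × ℝ} (hp : p ∈ slab v₀ v) : fluxDensity M a r p =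
      deriv M p.1 * fluxA a r p.2.1 + deriv (deriv M) p.1 * fluxB a r p.2.1 := by
  have hx : ![p.1, r, p.2.1, p.2.2] ∈ domain := ⟨hr, hp.2.1, hp.2.2⟩
  have h2 := invRhoSq_mul (a := a) hx
  rw [fluxDensity, sqrt_neg_det_metric hx]
  simp only [normal, Pi.single_apply, mul_ite, mul_one, mul_zero, Finset.sum_ite_eq',
    Finset.mem_univ, if_true, axialCurrent_eq hM hM' hx (show (1 : Fin 4) ≠ 3 by decide)]
  simp only [currentPoly, invRhoSq, rhoSq, fluxA, fluxB, Matrix.cons_val] at h2 ⊢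
  grind

theorem denom_pos (hr : 0 < r) (θ : ℝ) : 0 < r ^ 2 + a ^ 2 * cos θ ^ 2 := by positivity

theorem continuous_fluxA (hr : 0 < r) : Continuous (fluxA a r) := by
  unfold fluxA
  have (θ : ℝ) := (denom_pos (a := a) hr θ).ne'
  fun_prop (disch := assumption)

theorem continuous_fluxB (hr : 0 < r) : Continuous (fluxB a r) := by
  unfold fluxB
  have (θ : ℝ) := (denom_pos (a := a) hr θ).ne'
  fun_prop (disch := assumption)

theorem hasDerivAt_inv_denom (hr : 0 < r) (θ : ℝ) :
    HasDerivAt (fun θ => (r ^ 2 + a ^ 2 * cos θ ^ 2)⁻¹)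
      (2 * a ^ 2 * sin θ * cos θ * (r ^ 2 + a ^ 2 * cos θ ^ 2)⁻¹ ^ 2) θ :=
  (((((hasDerivAt_cos θ).fun_pow 2).const_mul (a ^ 2)).const_add (r ^ 2)).fun_inv
    (denom_pos hr θ).ne').congr_deriv (by field)

theorem integral_fluxA (hr : 0 < r) : ∫ θ in 0..π, fluxA a r θ = -4 * a := by
  -- The second term of the antiderivative carries `sin⁴` and vanishes at both endpoints, so the
  -- integral does not depend on `r`.
  have hF (θ : ℝ) : HasDerivAt (fun θ => a * (3 * cos θ - cos θ ^ 3) +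
      a ^ 3 * (sin θ ^ 4 * cos θ * (r ^ 2 + a ^ 2 * cos θ ^ 2)⁻¹)) (fluxA a r θ) θ := by
    refine (((((hasDerivAt_cos θ).const_mul 3).sub ((hasDerivAt_cos θ).fun_pow 3)).const_mul a).add
      (((((hasDerivAt_sin θ).fun_pow 4).fun_mul (hasDerivAt_cos θ)).fun_mul
        (hasDerivAt_inv_denom (a := a) hr θ)).const_mul (a ^ 3))).congr_deriv ?_
    have := sin_sq_add_cos_sq θ
    simp only [fluxA]
    grind
  rw [intervalIntegral.integral_eq_sub_of_hasDerivAt (fun θ _ => hF θ)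
    ((continuous_fluxA hr).intervalIntegrable _ _)]
  simp
  ring

theorem integral_fluxB (hr : 0 < r) : ∫ θ in 0..π, fluxB a r θ = 4 * ell a r := by
  rcases eq_or_ne a 0 with rfl | ha
  · simp [fluxB, ell]
  -- Substituting `x = cos θ`, polynomial division of `(1 - x²)²` by `r² + a² x²` gives a quadratic
  -- polynomial and the constant remainder `(r² + a²)²/a⁴`, the source of the arctangent.
  have hF (θ : ℝ) : HasDerivAt (fun θ => -(a * r / 3) * cos θ ^ 3 +
      (2 * a * r + r ^ 3 / a) * cos θ -
      (r ^ 2 + a ^ 2) ^ 2 / a ^ 2 * arctan (a / r * cos θ)) (fluxB a r θ) θ := by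
    refine (((((hasDerivAt_cos θ).fun_pow 3).const_mul (-(a * r / 3))).add
      ((hasDerivAt_cos θ).const_mul (2 * a * r + r ^ 3 / a))).sub
      ((((hasDerivAt_cos θ).const_mul (a / r)).arctan).const_mul
        ((r ^ 2 + a ^ 2) ^ 2 / a ^ 2))).congr_deriv ?_
    have h1 := sin_sq_add_cos_sq θ
    have h2 := (denom_pos (a := a) hr θ).ne'
    have h3 : 1 + (a / r * cos θ) ^ 2 ≠ 0 := by positivity
    have h4 : 1 + (a / r * cos θ) ^ 2 = (r ^ 2 + a ^ 2 * cos θ ^ 2) / r ^ 2 := by field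
    have h5 : sin θ ^ 5 = sin θ * (1 - cos θ ^ 2) ^ 2 := by rw [← sin_sq]; ring
    rw [fluxB, h4, h5]
    field_simp
    ring
  rw [intervalIntegral.integral_eq_sub_of_hasDerivAt (fun θ _ => hF θ)
    ((continuous_fluxB hr).intervalIntegrable _ _)]
  simp [ell, ha]
  field_simp
  ring

/-! ### Integration over the slab and the limit of the charge -/

theorem integrableOn_slab {f : ℝ × ℝ × ℝ → ℝ} (hf : Continuous f) (v₀ v : ℝ) :
    IntegrableOn f (slab v₀ v) :=
  (hf.continuousOn.integrableOn_compact (isCompact_Icc.prod (isCompact_Icc.prod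
    isCompact_Icc))).mono_set
      (prod_mono Ioo_subset_Icc_self (prod_mono Ioo_subset_Icc_self Ioo_subset_Icc_self))

theorem measurableSet_slab (v₀ v : ℝ) : MeasurableSet (slab v₀ v) :=
  measurableSet_Ioo.prod (measurableSet_Ioo.prod measurableSet_Ioo)

/-- Fubini for a product integrand; the `ψ`-integral contributes `2π`. -/
theorem setIntegral_slab {v₀ v : ℝ} (hv : v₀ ≤ v) (f g : ℝ → ℝ) :
    ∫ p in slab v₀ v, f p.1 * g p.2.1 = (∫ w in v₀..v, f w) * ((∫ θ in 0..π, g θ) * (2 * π)) := by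
  have h := setIntegral_prod_mul (μ := volume) (ν := (volume : Measure (ℝ × ℝ))) f
    (fun z => g z.1) (Ioo v₀ v) (Ioo 0 π ×ˢ Ioo 0 (2 * π))
  have h' := setIntegral_prod_mul (μ := (volume : Measure ℝ)) (ν := (volume : Measure ℝ)) g
    (fun _ => 1) (Ioo 0 π) (Ioo 0 (2 * π))
  simp only [mul_one] at h'
  rw [slab, Measure.volume_eq_prod, h, Measure.volume_eq_prod, h',
    intervalIntegral.integral_of_le hv, intervalIntegral.integral_of_le pi_pos.le,
    integral_Ioc_eq_integral_Ioo, integral_Ioc_eq_integral_Ioo]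
  simp [pi_pos.le]

theorem contDiff_deriv (hM : ContDiff ℝ 2 M) : ContDiff ℝ 1 (deriv M) :=
  (contDiff_succ_iff_deriv.1 (show ContDiff ℝ (1 + 1) M by simpa [one_add_one_eq_two] using hM)).2.2

theorem continuous_deriv_deriv (hM : ContDiff ℝ 2 M) : Continuous (deriv (deriv M)) :=
  (contDiff_deriv hM).continuous_deriv le_rfl

theorem differentiable_deriv (hM : ContDiff ℝ 2 M) : Differentiable ℝ (deriv M) :=
  (contDiff_deriv hM).differentiable one_ne_zero

theorem continuous_flux (hM : ContDiff ℝ 2 M) (hr : 0 < r) :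
    Continuous (fun p : ℝ × ℝ × ℝ => deriv M p.1 * fluxA a r p.2.1) ∧
      Continuous (fun p : ℝ × ℝ × ℝ => deriv (deriv M) p.1 * fluxB a r p.2.1) := by
  have h1 := continuous_fluxA (a := a) hr
  have h2 := continuous_fluxB (a := a) hr
  have h3 := (contDiff_deriv hM).continuous
  have h4 := continuous_deriv_deriv hM
  constructor <;> fun_prop

theorem integrableOn_fluxDensity (hM : ContDiff ℝ 2 M) (hr : 0 < r) (v₀ v : ℝ) :
    IntegrableOn (fluxDensity M a r) (slab v₀ v) :=
  (integrableOn_slab ((continuous_flux hM hr).1.add (continuous_flux hM hr).2) v₀ v).congr_fun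
    (fun _ hp => (fluxDensity_eq (hM.differentiable two_ne_zero) (differentiable_deriv hM) hr
      hp).symm) (measurableSet_slab v₀ v)

/-- The constants combine as `-(1/8π) · 2π · (-4a) = a` and `-(1/8π) · 2π · 4 ell = -ell`. -/
theorem partialCharge_eq (hM : ContDiff ℝ 2 M) (hr : 0 < r) {v₀ v : ℝ} (hv : v₀ ≤ v) :
    partialCharge M a r v v₀ =
      (M v - M v₀) * a - (deriv M v - deriv M v₀) * ell a r := by
  have hM1 := hM.differentiable two_ne_zero
  have hM2 := differentiable_deriv hM
  have hc := continuous_flux (a := a) hM hr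
  rw [partialCharge, setIntegral_congr_fun (measurableSet_slab v₀ v)
    fun p hp => fluxDensity_eq hM1 hM2 hr hp,
    integral_add (integrableOn_slab hc.1 v₀ v) (integrableOn_slab hc.2 v₀ v),
    setIntegral_slab hv, setIntegral_slab hv, integral_fluxA hr, integral_fluxB hr,
    intervalIntegral.integral_deriv_eq_sub (fun w _ => hM1 w)
      ((contDiff_deriv hM).continuous.intervalIntegrable _ _),
    intervalIntegral.integral_deriv_eq_sub (fun w _ => hM2 w)
      ((continuous_deriv_deriv hM).intervalIntegrable _ _)]
  field

theorem tendsto_partialCharge (hM : ContDiff ℝ 2 M) (hM0 : Tendsto M atBot (𝓝 0))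
    (hM1 : Tendsto (deriv M) atBot (𝓝 0)) (hr : 0 < r) (v : ℝ) :
    Tendsto (partialCharge M a r v) atBot (𝓝 (M v * a - deriv M v * ell a r)) := by
  have h := ((hM0.const_sub (M v)).mul_const a).sub
    ((hM1.const_sub (deriv M v)).mul_const (ell a r))
  simp only [sub_zero] at h
  refine h.congr' ?_
  filter_upwards [eventually_le_atBot v] with v₀ hv using (partialCharge_eq hM hr hv).symm

/-- In the closed form the growing terms cancel. The representation `4 ell = ∫ fluxB` avoids
expanding the arctangent: the integrand is at most `|a|³/r` in absolute value. -/
theorem tendsto_ell : Tendsto (ell a) atTop (𝓝 0) := by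
  have hb : ∀ᶠ r in atTop, ‖ell a r‖ ≤ |a| ^ 3 * π / 4 * r⁻¹ := by
    filter_upwards [eventually_gt_atTop 0] with r hr
    have h := intervalIntegral.norm_integral_le_of_norm_le_const (a := 0) (b := π)
      (f := fluxB a r) (C := |a| ^ 3 * r⁻¹) fun θ _ => by
        have h1 : |sin θ| ^ 5 ≤ 1 := pow_le_one₀ (abs_nonneg _) (abs_sin_le_one θ)
        have h2 : (r ^ 2 + a ^ 2 * cos θ ^ 2)⁻¹ ≤ (r ^ 2)⁻¹ :=
          inv_anti₀ (by positivity) (le_add_of_nonneg_right (by positivity))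
        rw [fluxB, norm_mul, norm_mul, norm_mul, norm_pow, norm_pow, norm_of_nonneg hr.le,
          norm_of_nonneg (inv_nonneg.2 (denom_pos hr θ).le), norm_eq_abs, norm_eq_abs]
        calc |a| ^ 3 * r * |sin θ| ^ 5 * (r ^ 2 + a ^ 2 * cos θ ^ 2)⁻¹
            ≤ |a| ^ 3 * r * 1 * (r ^ 2)⁻¹ := by gcongr
          _ = |a| ^ 3 * r⁻¹ := by field_simp
    rw [integral_fluxB hr, norm_mul, sub_zero, abs_of_pos pi_pos, norm_of_nonneg (by norm_num)] at h
    linarith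
  refine squeeze_zero_norm' hb ?_
  have h : Tendsto (fun r : ℝ => r⁻¹) atTop (𝓝 0) := tendsto_inv_atTop_zero
  simpa only [mul_zero] using h.const_mul (|a| ^ 3 * π / 4)

end KerrVaidya

end

/-- The axial field is Killing and its current is conserved; the charge integral exists and has
the stated value, for every advanced time `v` and every `r > 0`; it tends to the angular momentum
`M(v) a` of the Kerr metric of mass `M(v)` as `r → ∞`. -/
theorem corollary1 (M : ℝ → ℝ) (a : ℝ) (hM : ContDiff ℝ 2 M)
    (hM0 : Tendsto M atBot (𝓝 0)) (hM1 : Tendsto (deriv M) atBot (𝓝 0)) :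
    (∀ x ∈ KerrVaidya.domain, Spacetime.KillingAt (KerrVaidya.metric M a) KerrVaidya.axial x) ∧
    (∀ x ∈ KerrVaidya.domain,
      Spacetime.ConservedAt (KerrVaidya.metric M a) (KerrVaidya.axialCurrent M a) x) ∧
    (∀ v r : ℝ, 0 < r →
      (∀ v₀ : ℝ, IntegrableOn (KerrVaidya.fluxDensity M a r) (KerrVaidya.slab v₀ v)) ∧
      Tendsto (KerrVaidya.partialCharge M a r v) atBot (𝓝 (KerrVaidya.charge M a r v)) ∧
      KerrVaidya.charge M a r v = M v * a - deriv M v * KerrVaidya.ell a r) ∧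
    (∀ v : ℝ, Tendsto (fun r => KerrVaidya.charge M a r v) atTop (𝓝 (M v * a))) := by
  have hd := hM.differentiable two_ne_zero
  have hd' := KerrVaidya.differentiable_deriv hM
  -- `charge` is a `limUnder`, meaningful only under convergence; this limit supplies both its
  -- existence and its value.
  have hlim {v r : ℝ} (hr : 0 < r) :=
    KerrVaidya.tendsto_partialCharge (a := a) hM hM0 hM1 hr v
  refine ⟨fun x hx => Spacetime.killingAt_single KerrVaidya.isSymm_metric
      (KerrVaidya.isUnit_det_metric hx) KerrVaidya.metric_update_three,
    fun x hx => KerrVaidya.conservedAt_axialCurrent hd hd' hx,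
    fun v r hr => ⟨fun v₀ => KerrVaidya.integrableOn_fluxDensity hM hr v₀ v, ?_,
      (hlim hr).limUnder_eq⟩, fun v => ?_⟩
  · rw [KerrVaidya.charge, (hlim hr).limUnder_eq]
    exact hlim hr
  · have h := (KerrVaidya.tendsto_ell (a := a)).const_mul (deriv M v)
    rw [mul_zero] at h
    have h' := h.const_sub (M v * a)
    rw [sub_zero] at h'
    refine h'.congr' ?_
    filter_upwards [eventually_gt_atTop 0] with r hr using (hlim hr).limUnder_eq.symm
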